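/- Let $M$ be a smooth manifold with a smooth Riemannian metric $g$, and write forms as $\omega=\omega_{M_1\dots M_n}\,dx^{M_1}\wedge\cdots\wedge dx^{M_n}$ (sum over all values of the indices, no factor $1/n!$). Let $I$ be an integrable complex structure on $M$, i.e. a smooth field of endomorphisms $I^M{}_N$ of the tangent spaces with $I^2=-1$ and vanishing Nijenhuis tensor, and suppose that $g$ is Hermitian with respect to $I$, $g(IX,IY)=g(X,Y)$. Put $I_{MN}=g_{MP}I^P{}_N$, and let $\Omega_I=I_{MN}\,dx^M\wedge dx^N$ be the fundamental $2$-form. Let $d_I=[d,\iota]=d\iota-\iota d$, where $\iota$ is the algebraic operator $(\iota\omega)(X_1,\dots,X_n)=\sum_i\omega(X_1,\dots,IX_i,\dots,X_n)$. A Bismut connection of $(g,I)$ is an affine connection $\hat\nabla$ with $\hat\nabla g=0$, $\hat\nabla I=0$ whose torsion tensor $C_{LNK}=g_{LM}T^M{}_{NK}$, where $T(X,Y)=\hat\nabla_XY-\hat\nabla_YX-[X,Y]$, is totally antisymmetric. Then a Bismut connection exists, and the torsion tensor $C$ of any Bismut connection satisfies $$d_I\Omega_I=\tfrac13\,C_{MPQ}\,dx^M\wedge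 dx^P\wedge dx^Q$$ (in particular $C$ is uniquely determined by $g$ and $I$). Consequently, if $(M,g,I,J,K)$ is an HKT manifold, i.e. $I,J,K$ are integrable complex structures with $IJ=K$, $JK=I$, $KI=J$, the metric $g$ is Hermitian with respect to each of them, and one and the same connection is a Bismut connection for $I$, for $J$ and for $K$, then $$d_I\Omega_I=d_J\Omega_J=d_K\Omega_K .$$ -/

import Mathlib

open scoped Manifold ContDiff Bundle

noncomputable section

namespace TorsionGeometry

/-! ### Tensor fields and differential forms on a smooth manifold `M` modelled on `E` -/

/-- Fields of endomorphisms of the tangent spaces, i.e. `(1,1)`-tensor fields `I^M_N`. -/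
abbrev EndField (E : Type*) [NormedAddCommGroup E] [NormedSpace ℝ E] (M : Type*)
    [TopologicalSpace M] [ChartedSpace E M] : Type _ :=
  Π x : M, TangentSpace 𝓘(ℝ, E) x →L[ℝ] TangentSpace 𝓘(ℝ, E) x

/-- Covariant tensor fields of rank `n`, with components `T_{M₁ … Mₙ}`. -/
abbrev CovTensorField (E : Type*) [NormedAddCommGroup E] [NormedSpace ℝ E] (M : Type*)
    [TopologicalSpace M] [ChartedSpace E M] (n : ℕ) : Type _ :=
  Π x : M, ContinuousMultilinearMap ℝ (fun _ : Fin n => TangentSpace 𝓘(ℝ, E) x) ℝ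

/-- Differential forms of degree `n`. -/
abbrev DiffForm (E : Type*) [NormedAddCommGroup E] [NormedSpace ℝ E] (M : Type*)
    [TopologicalSpace M] [ChartedSpace E M] (n : ℕ) : Type _ :=
  Π x : M, TangentSpace 𝓘(ℝ, E) x [⋀^Fin n]→L[ℝ] ℝ

/-- Vector fields. -/
abbrev VecField (E : Type*) [NormedAddCommGroup E] [NormedSpace ℝ E] (M : Type*)
    [TopologicalSpace M] [ChartedSpace E M] : Type _ :=
  Π x : M, TangentSpace 𝓘(ℝ, E) x

/-- Smooth Riemannian metrics on `M`. -/
abbrev RiemMetric (E : Type*) [NormedAddCommGroup E] [NormedSpace ℝ E] (M : Type*)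
    [TopologicalSpace M] [ChartedSpace E M] [IsManifold 𝓘(ℝ, E) ∞ M] : Type _ :=
  Bundle.ContMDiffRiemannianMetric 𝓘(ℝ, E) ∞ E (fun x : M => TangentSpace 𝓘(ℝ, E) x)

/-- Affine connections on `M`; `∇_v Y` at `x` is written `D Y x v`. -/
abbrev Connection (E : Type*) [NormedAddCommGroup E] [NormedSpace ℝ E] (M : Type*)
    [TopologicalSpace M] [ChartedSpace E M] [IsManifold 𝓘(ℝ, E) ∞ M] : Type _ :=
  CovariantDerivative 𝓘(ℝ, E) E (fun x : M => TangentSpace 𝓘(ℝ, E) x)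

section Forms

variable {E : Type*} [NormedAddCommGroup E] [NormedSpace ℝ E]
  {M : Type*} [TopologicalSpace M] [ChartedSpace E M]

/-- The form `T_{M₁ … Mₙ} dx^{M₁} ∧ … ∧ dx^{Mₙ}` (sum over all values of all the indices, no
factor `1 / n!`). With `dx ∧ dy = dx ⊗ dy - dy ⊗ dx`, its value on `v₁, …, vₙ` is
`∑ σ, sign σ • T (v_{σ 1}, …, v_{σ n})`. -/
def CovTensorField.toForm {n : ℕ} (T : CovTensorField E M n) : DiffForm E M n :=
  fun x => ContinuousMultilinearMap.alternatization (T x)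

/-- The form `α` read in the chart centred at `x₀`, as a form on (an open subset of) `E`. -/
def inChart {n : ℕ} (α : DiffForm E M n) (x₀ : M) : E → E [⋀^Fin n]→L[ℝ] ℝ :=
  fun y => (α ((extChartAt 𝓘(ℝ, E) x₀).symm y)).compContinuousLinearMap
    (mfderiv 𝓘(ℝ, E) 𝓘(ℝ, E) (extChartAt 𝓘(ℝ, E) x₀).symm y)

/-- The exterior derivative `d`: at `x` it is computed in the chart centred at `x`. -/
def extD {n : ℕ} (α : DiffForm E M n) : DiffForm E M (n + 1) :=
  fun x => (extDeriv (inChart α x) (extChartAt 𝓘(ℝ, E) x x)).compContinuousLinearMap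
    (mfderiv 𝓘(ℝ, E) 𝓘(ℝ, E) (extChartAt 𝓘(ℝ, E) x) x)

/-- The algebraic derivation of alternating forms induced by an endomorphism `A`:
`(v₁, …, vₙ) ↦ ∑ i, α (v₁, …, A vᵢ, …, vₙ)`. -/
def derivationExt {V : Type*} [AddCommGroup V] [Module ℝ V] [TopologicalSpace V] {n : ℕ}
    (A : V →L[ℝ] V) (α : V [⋀^Fin n]→L[ℝ] ℝ) : V [⋀^Fin n]→L[ℝ] ℝ :=
  { (∑ i : Fin n, α.toContinuousMultilinearMap.compContinuousLinearMap
      (Function.update (fun _ => ContinuousLinearMap.id ℝ V) i A)) with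
    map_eq_zero_of_eq' := by
      intro v i j hv hij
      have key : ∀ k : Fin n, (fun l => (Function.update (fun _ => ContinuousLinearMap.id ℝ V) k A
          : Fin n → V →L[ℝ] V) l (v l)) = Function.update v k (A (v k)) := by
        intro k
        funext l
        by_cases h : l = k
        · subst h; simp
        · simp [h]
      have hsum : ∑ k : Fin n, α (Function.update v k (A (v k))) = 0 := by
        rw [Finset.sum_eq_add_of_mem i j (Finset.mem_univ _) (Finset.mem_univ _) hij]
        · have h1 : Function.update v j (A (v j))
              = Function.update v i (A (v i)) ∘ Equiv.swap i j := by
            funext l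
            by_cases hi : l = i
            · subst hi; simp [hij, hij.symm, hv]
            · by_cases hj : l = j
              · subst hj; simp [hv]
              · simp [Equiv.swap_apply_of_ne_of_ne hi hj, hi, hj]
          rw [h1]
          have h2 := α.toAlternatingMap.map_swap (Function.update v i (A (v i))) hij
          simp only [ContinuousAlternatingMap.coe_toAlternatingMap] at h2
          rw [h2]
          simp
        · intro k _ hk
          refine α.map_eq_zero_of_eq _ ?_ hij
          simp [hk.1.symm, hk.2.symm, hv]
      simpa [sum_apply, key] using hsum }

/-- The operator `ι` attached to `I`: in components
`ι α = n α_{N [M₂ … Mₙ} I^N_{M₁]} dx^{M₁} ∧ … ∧ dx^{Mₙ}`. -/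
def iotaOp {n : ℕ} (I : EndField E M) (α : DiffForm E M n) : DiffForm E M n :=
  fun x => derivationExt (I x) (α x)

/-- The operator `d_I = [d, ι]`. -/
def dOp {n : ℕ} (I : EndField E M) (α : DiffForm E M n) : DiffForm E M (n + 1) :=
  extD (iotaOp I α) - iotaOp I (extD α)

end Forms

section Geometry

variable {E : Type*} [NormedAddCommGroup E] [NormedSpace ℝ E]
  {M : Type*} [TopologicalSpace M] [ChartedSpace E M] [IsManifold 𝓘(ℝ, E) ∞ M]

/-- The vector field `I X`. -/
def EndField.applyField (I : EndField E M) (X : VecField E M) : VecField E M :=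
  fun x => I x (X x)

/-- An (integrable) complex structure: a smooth field of endomorphisms with `I ^ 2 = -1` and
vanishing Nijenhuis tensor. -/
structure IsComplexStructure (I : EndField E M) : Prop where
  smooth : ContMDiff 𝓘(ℝ, E) (𝓘(ℝ, E).prod 𝓘(ℝ, E →L[ℝ] E)) ∞
    (fun x : M => Bundle.TotalSpace.mk' (E →L[ℝ] E)
      (E := fun x : M => TangentSpace 𝓘(ℝ, E) x →L[ℝ] TangentSpace 𝓘(ℝ, E) x) x (I x))
  sq_eq_neg : ∀ (x : M) (v : TangentSpace 𝓘(ℝ, E) x), I x (I x v) = -v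
  nijenhuis_eq_zero : ∀ (X Y : VecField E M) (x : M), MDiffAt (T% X) x → MDiffAt (T% Y) x →
    VectorField.mlieBracket 𝓘(ℝ, E) (I.applyField X) (I.applyField Y) x
      - I x (VectorField.mlieBracket 𝓘(ℝ, E) (I.applyField X) Y x)
      - I x (VectorField.mlieBracket 𝓘(ℝ, E) X (I.applyField Y) x)
      - VectorField.mlieBracket 𝓘(ℝ, E) X Y x = 0

/-- The metric is Hermitian with respect to `I`. -/
def IsHermitian (g : RiemMetric E M) (I : EndField E M) : Prop :=
  ∀ (x : M) (v w : TangentSpace 𝓘(ℝ, E) x), g.inner x (I x v) (I x w) = g.inner x v w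

/-- The tensor `I_{MN} = g_{MP} I^P_N`, i.e. `(v, w) ↦ g (v, I w)`. -/
def lowered (g : RiemMetric E M) (I : EndField E M) : CovTensorField E M 2 :=
  fun x =>
    { toFun := fun v => g.inner x (v 0) (I x (v 1))
      map_update_add' := by
        intro inst m i a b
        obtain rfl : inst = instDecidableEqFin 2 := Subsingleton.elim _ _
        fin_cases i <;> simp
      map_update_smul' := by
        intro inst m i a b
        obtain rfl : inst = instDecidableEqFin 2 := Subsingleton.elim _ _
        fin_cases i <;> simp
      cont := by
        have h : Continuous fun v : Fin 2 → E =>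
            (show E →L[ℝ] E →L[ℝ] ℝ from g.inner x) (v 0) ((show E →L[ℝ] E from I x) (v 1)) := by
          fun_prop
        exact h }

/-- The fundamental `2`-form `Ω_I = I_{MN} dx^M ∧ dx^N`. -/
def fundamentalForm (g : RiemMetric E M) (I : EndField E M) : DiffForm E M 2 :=
  (lowered g I).toForm

variable [FiniteDimensional ℝ E]

/-- The torsion `T (v, w)` of a connection at `x`, characterised by
`T (X, Y) = ∇_X Y - ∇_Y X - [X, Y]`. -/
def torsion (D : Connection E M) (x : M) :
    TangentSpace 𝓘(ℝ, E) x →L[ℝ] TangentSpace 𝓘(ℝ, E) x →L[ℝ] TangentSpace 𝓘(ℝ, E) x :=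
  haveI : CompleteSpace E := FiniteDimensional.complete ℝ E
  CovariantDerivative.torsion D x

/-- The torsion tensor with all indices down, `C_{LNK} = g_{LM} T^M_{NK}`. -/
def torsionTensor (g : RiemMetric E M) (D : Connection E M) : CovTensorField E M 3 :=
  fun x =>
    { toFun := fun v => g.inner x (v 0) (torsion D x (v 1) (v 2))
      map_update_add' := by
        intro inst m i a b
        obtain rfl : inst = instDecidableEqFin 3 := Subsingleton.elim _ _
        fin_cases i <;> simp
      map_update_smul' := by
        intro inst m i a b
        obtain rfl : inst = instDecidableEqFin 3 := Subsingleton.elim _ _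
        fin_cases i <;> simp
      cont := by
        have h : Continuous fun v : Fin 3 → E =>
            (show E →L[ℝ] E →L[ℝ] ℝ from g.inner x) (v 0)
              ((show E →L[ℝ] E →L[ℝ] E from torsion D x) (v 1) (v 2)) := by
          fun_prop
        exact h }

/-- `D` is a Bismut connection of `(g, I)`: `∇ g = 0`, `∇ I = 0`, and the torsion tensor
`C_{LNK}` is totally antisymmetric. -/
structure IsBismutConnection (g : RiemMetric E M) (I : EndField E M) (D : Connection E M) :
    Prop where
  metric : ∀ (Y Z : VecField E M) (x : M), MDiffAt (T% Y) x → MDiffAt (T% Z) x →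
    ∀ v : TangentSpace 𝓘(ℝ, E) x,
      mfderiv 𝓘(ℝ, E) 𝓘(ℝ, ℝ) (fun y => g.inner y (Y y) (Z y)) x v
        = g.inner x (D Y x v) (Z x) + g.inner x (Y x) (D Z x v)
  parallel : ∀ (Y : VecField E M) (x : M), MDiffAt (T% Y) x →
    ∀ v : TangentSpace 𝓘(ℝ, E) x, D (I.applyField Y) x v = I x (D Y x v)
  skew : ∀ (x : M) (σ : Equiv.Perm (Fin 3)) (v : Fin 3 → TangentSpace 𝓘(ℝ, E) x),
    torsionTensor g D x (v ∘ σ) = ((Equiv.Perm.sign σ : ℤ) : ℝ) * torsionTensor g D x v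

/-- `(g, I, J, K)` is an HKT structure: three integrable complex structures satisfying the
quaternion algebra, a metric Hermitian with respect to each of them, and one and the same
Bismut connection for `I`, `J` and `K`. -/
structure IsHKT (g : RiemMetric E M) (I J K : EndField E M) : Prop where
  complex_I : IsComplexStructure I
  complex_J : IsComplexStructure J
  complex_K : IsComplexStructure K
  hermitian_I : IsHermitian g I
  hermitian_J : IsHermitian g J
  hermitian_K : IsHermitian g K
  mul_IJ : ∀ (x : M) (v : TangentSpace 𝓘(ℝ, E) x), I x (J x v) = K x v
  mul_JK : ∀ (x : M) (v : TangentSpace 𝓘(ℝ, E) x), J x (K x v) = I x v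
  mul_KI : ∀ (x : M) (v : TangentSpace 𝓘(ℝ, E) x), K x (I x v) = J x v
  common_bismut : ∃ D : Connection E M,
    IsBismutConnection g I D ∧ IsBismutConnection g J D ∧ IsBismutConnection g K D

end Geometry

end TorsionGeometry

end

open TorsionGeometry

noncomputable section

namespace TorsionGeometry

open scoped Manifold ContDiff Bundle

/-! Every condition involved is an identity at a single point in the values and first derivatives of
`g` and `I`. In the chart centred at `x` a connection is the flat derivative plus a bilinear map
`A`, and being Bismut becomes a system of linear equations on `A` over the jet of `(g, I)` at `x`.
The theorem is thereby reduced to linear algebra (`HermitianJet`).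

Existence (`exists_isBismut`): take the Levi-Civita coefficients plus half of the 3-form `C` that is
the cyclic sum of `g (v, (∇_{Ju} J) w)`. Antisymmetry of `C` preserves metricity. Parallelism of `J`
is an identity between `∇J` and `C` (`nablaJ_add_bismutTorsion`), which rests on `∇_{Ju} J = -J ∇_u
J`, the form taken by the vanishing of the Nijenhuis tensor.

Torsion formula (`IsBismut.dOmega_eq`): `Ω` is parallel, so `dΩ` is purely a torsion term, twice the
sum of `C` with `J` inserted in each slot. Since `Ω` has type (1,1), `ι Ω = 0` and `d_I Ω = -ι dΩ`.
Inserting `J` once more and using the Nijenhuis condition on `C` leaves `2 C`. As `C` is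
antisymmetric, its associated form has value `3! C`, whence the factor `1/3`.

In the HKT case the right-hand side involves only the common connection, so the three left-hand
sides agree. -/

/-- The first-order jet at a point of a Hermitian structure with vanishing Nijenhuis tensor:
a metric `g` and a complex structure `J` together with their first derivatives. -/
structure HermitianJet (V : Type*) [AddCommGroup V] [Module ℝ V] where
  g : V →ₗ[ℝ] V →ₗ[ℝ] ℝ
  J : V →ₗ[ℝ] V
  dg : V →ₗ[ℝ] V →ₗ[ℝ] V →ₗ[ℝ] ℝ
  dJ : V →ₗ[ℝ] V →ₗ[ℝ] V
  symm : ∀ v w, g v w = g w v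
  pos : ∀ v, v ≠ 0 → 0 < g v v
  sq : ∀ v, J (J v) = -v
  herm : ∀ v w, g (J v) (J w) = g v w
  dg_symm : ∀ u v w, dg u v w = dg u w v
  dsq : ∀ u v, dJ u (J v) + J (dJ u v) = 0
  dherm : ∀ u v w, dg u (J v) (J w) + g (dJ u v) (J w) + g (J v) (dJ u w) = dg u v w
  nijenhuis : ∀ u v, dJ (J u) v - dJ (J v) u + J (dJ v u) - J (dJ u v) = 0

/-! ### The Levi-Civita derivative of `J` and the candidate torsion. -/

namespace HermitianJet

variable {V : Type*} [AddCommGroup V] [Module ℝ V] (S : HermitianJet V)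

lemma g_J_left (v w : V) : S.g (S.J v) w = -S.g v (S.J w) := by
  rw [← S.herm v (S.J w), S.sq]; simp

/-- The coefficients of the Levi-Civita connection with all indices lowered:
`g (∇_u v, z)` for constant `v`. -/
def christoffel (u v z : V) : ℝ := (1 / 2) * (S.dg u v z + S.dg v u z - S.dg z u v)

/-- `g (v, (∇_u J) w)` for the Levi-Civita connection. -/
def nablaJ (u v w : V) : ℝ :=
  S.g v (S.dJ u w) + S.christoffel u (S.J w) v + S.christoffel u w (S.J v)

/-- The torsion of the Bismut connection. -/
def bismutTorsion (u v w : V) : ℝ :=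
  S.nablaJ (S.J u) v w + S.nablaJ (S.J v) w u + S.nablaJ (S.J w) u v

/-- `J` is skew-adjoint and the Levi-Civita connection is metric, so `∇_u J` is skew-adjoint as
well. -/
lemma nablaJ_swap (u v w : V) : S.nablaJ u v w = -S.nablaJ u w v := by
  have h := S.dherm u v (S.J w)
  have h1 : S.dJ u (S.J w) = -S.J (S.dJ u w) := eq_neg_of_add_eq_zero_left (S.dsq u w)
  have h2 := S.symm w (S.dJ u v)
  have h3 := S.herm v (S.dJ u w)
  simp only [S.sq, h1, map_neg, h3] at h
  have := S.dg_symm u w (S.J v)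
  have := S.dg_symm u (S.J w) v
  have := S.dg_symm v (S.J w) u
  have := S.dg_symm v u (S.J w)
  have := S.dg_symm w (S.J v) u
  have := S.dg_symm (S.J w) u v
  have := S.dg_symm (S.J v) u w
  simp only [nablaJ, christoffel]
  linarith

/-- Differentiating `J² = -1` shows that `∇_u J` anticommutes with `J`; the isometry property of `J`
then absorbs the remaining `J`. -/
lemma nablaJ_J_J (u v w : V) : S.nablaJ u (S.J v) (S.J w) = -S.nablaJ u v w := by
  have h1 : S.dJ u (S.J w) = -S.J (S.dJ u w) := eq_neg_of_add_eq_zero_left (S.dsq u w)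
  simp only [nablaJ, christoffel, S.sq, h1, map_neg, S.herm, LinearMap.neg_apply]
  ring

lemma nablaJ_J_right (u v w : V) : S.nablaJ u v (S.J w) = S.nablaJ u (S.J v) w := by
  have := S.nablaJ_J_J u (S.J v) w
  simp only [S.sq] at this
  simp only [nablaJ, christoffel, S.sq, map_neg, LinearMap.neg_apply] at this ⊢
  linarith

lemma christoffel_comm (u v z : V) : S.christoffel u v z = S.christoffel v u z := by
  have := S.dg_symm z u v
  simp only [christoffel]
  linarith

/-- In the Nijenhuis tensor partial derivatives may be replaced by covariant ones of a torsion-free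
connection: the Christoffel terms cancel by symmetry. -/
lemma nablaJ_nijenhuis (p q r : V) :
    S.nablaJ (S.J p) r q - S.nablaJ (S.J q) r p - S.nablaJ q (S.J r) p + S.nablaJ p (S.J r) q
      = 0 := by
  have h := congrArg (S.g r) (S.nijenhuis p q)
  simp only [map_add, map_sub, map_zero] at h
  have h1 := S.g_J_left r (S.dJ p q)
  have h2 := S.g_J_left r (S.dJ q p)
  have c1 := S.christoffel_comm (S.J p) (S.J q) r
  have c2 := S.christoffel_comm (S.J p) q (S.J r)
  have c3 := S.christoffel_comm (S.J q) p (S.J r)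
  have c4 := S.christoffel_comm p q r
  simp only [nablaJ, S.sq]
  have e1 : S.christoffel p q (-r) = -S.christoffel p q r := by simp [christoffel]; ring
  have e2 : S.christoffel q p (-r) = -S.christoffel q p r := by simp [christoffel]; ring
  rw [e1, e2]
  linarith

/-- `∇_{J u} J = - J ∇_u J`, an equivalent form of the vanishing of the Nijenhuis tensor. -/
lemma nablaJ_J_left (u v w : V) : S.nablaJ (S.J u) v w = -S.nablaJ u (S.J v) w := by
  -- Let `B u v w` be the sum of `nablaJ (J u) v w` and `nablaJ u (J v) w`. The Nijenhuis identity
  -- makes `B` symmetric in its outer arguments, while `s` and `t` make it antisymmetric in the last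
  -- two. The two symmetries are incompatible unless `B = 0`.
  have n1 := S.nablaJ_nijenhuis u w v
  have n2 := S.nablaJ_nijenhuis v u w
  have n3 := S.nablaJ_nijenhuis w v u
  have s (a b c : V) := S.nablaJ_swap a b c
  have t (a b c : V) : S.nablaJ a (S.J b) c = -S.nablaJ a (S.J c) b := by
    rw [← S.nablaJ_J_right, S.nablaJ_swap]
  have := s (S.J u) v w
  have := s (S.J v) u w
  have := s (S.J w) u v
  have := t u v w
  have := t v u w
  have := t w u v
  linarith

/-- Twice the equation `∇̂ J = 0` for `∇̂ = ∇ + C/2`, paired with `z`: the two torsion terms are the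
commutator of `C (u, ·)` with `J`. -/
lemma nablaJ_add_bismutTorsion (u z v : V) :
    2 * S.nablaJ u z v + S.bismutTorsion z u (S.J v) + S.bismutTorsion (S.J z) u v = 0 := by
  have e (x a b : V) : S.nablaJ (-x) a b = -S.nablaJ x a b := by
    simp [nablaJ, christoffel]; ring
  simp only [bismutTorsion, S.sq, S.nablaJ_J_left, S.nablaJ_J_right, e]
  have e' (x a b : V) : S.nablaJ x (-a) b = -S.nablaJ x a b := by
    simp [nablaJ, christoffel]; ring
  simp only [e']
  have t (a b c : V) : S.nablaJ a (S.J b) c = -S.nablaJ a (S.J c) b := by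
    rw [← S.nablaJ_J_right, S.nablaJ_swap]
  have := S.nablaJ_swap u z v
  linarith

lemma bismutTorsion_cycle (u v w : V) : S.bismutTorsion u v w = S.bismutTorsion v w u := by
  simp only [bismutTorsion]; ring

lemma bismutTorsion_swap (u v w : V) : S.bismutTorsion u v w = -S.bismutTorsion u w v := by
  have := S.nablaJ_swap (S.J u) v w
  have := S.nablaJ_swap (S.J v) w u
  have := S.nablaJ_swap (S.J w) u v
  simp only [bismutTorsion]; linarith

end HermitianJet

lemma exists_bilinear_of_lowered {V : Type*} [AddCommGroup V] [Module ℝ V]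
    [FiniteDimensional ℝ V] (g : V →ₗ[ℝ] V →ₗ[ℝ] ℝ)
    (hpos : ∀ v, v ≠ 0 → 0 < g v v) (τ : V →ₗ[ℝ] V →ₗ[ℝ] V →ₗ[ℝ] ℝ) :
    ∃ A : V →ₗ[ℝ] V →ₗ[ℝ] V, ∀ u v z, g (A u v) z = τ u v z := by
  let B : LinearMap.BilinForm ℝ V := g
  have hB : B.Nondegenerate := by
    refine ⟨fun v hv => ?_, fun v hv => ?_⟩ <;>
    · by_contra h
      exact (hpos v h).ne' (hv v)
  exact ⟨τ.compr₂ (B.toDual hB).symm.toLinearMap, fun u v z =>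
    LinearMap.BilinForm.apply_toDual_symm_apply (B := B) (hB := hB) (τ u v) z⟩

/-! ### Bismut coefficients at a point: existence and the formula for their torsion. -/

namespace HermitianJet

variable {V : Type*} [AddCommGroup V] [Module ℝ V] (S : HermitianJet V)

/-- Coefficients of a connection which preserves the metric and the complex structure and whose
torsion is totally antisymmetric; `A v u` stands for `∇_u v` with constant `v`. -/
structure IsBismut (A : V →ₗ[ℝ] V →ₗ[ℝ] V) : Prop where
  metric : ∀ u v w, S.dg u v w = S.g (A v u) w + S.g v (A w u)
  parallel : ∀ u v, S.dJ u v + A (S.J v) u = S.J (A v u)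
  skew : ∀ l n k, S.g l (A k n - A n k) = -S.g n (A k l - A l k)

lemma exists_isBismut [FiniteDimensional ℝ V] : ∃ A, S.IsBismut A := by
  -- `τ v u z` is the prospective `g (∇̂_u v, z)`, Levi-Civita plus half the torsion; the
  -- differentiated vector comes first, as in `A v u`. The metric then raises the last index.
  obtain ⟨τ, hτ⟩ : ∃ τ : V →ₗ[ℝ] V →ₗ[ℝ] V →ₗ[ℝ] ℝ, ∀ v u z,
      τ v u z = S.christoffel u v z + (1 / 2) * S.bismutTorsion z u v := by
    refine ⟨LinearMap.mk₂ ℝ (fun v u =>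
      { toFun := fun z => S.christoffel u v z + (1 / 2) * S.bismutTorsion z u v
        map_add' := ?_
        map_smul' := ?_ }) ?_ ?_ ?_ ?_, fun v u z => rfl⟩
    all_goals
      intros
      try ext z
      simp [christoffel, bismutTorsion, nablaJ]
      ring
  obtain ⟨A, hA⟩ := exists_bilinear_of_lowered S.g S.pos τ
  have hA' (u v z : V) : S.g z (A u v) = τ u v z := by rw [S.symm, hA]
  have hT (l n k : V) : S.g l (A k n - A n k) = S.bismutTorsion l n k := by
    rw [map_sub, hA', hA', hτ, hτ, S.christoffel_comm, S.bismutTorsion_swap l k n]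
    ring
  refine ⟨A, fun u v w => ?_, fun u v => ?_, fun l n k => ?_⟩
  · rw [hA, hA', hτ, hτ, S.bismutTorsion_cycle, S.bismutTorsion_swap, S.bismutTorsion_cycle v u w,
      ← S.bismutTorsion_cycle]
    have := S.dg_symm u v w
    have := S.dg_symm w v u
    have := S.dg_symm v w u
    have := S.dg_symm w u v
    have := S.bismutTorsion_cycle u v w
    have := S.bismutTorsion_swap u v w
    simp only [christoffel]
    linarith
  · have key (z : V) : S.g z (S.dJ u v + A (S.J v) u - S.J (A v u)) = 0 := by
      have h := S.nablaJ_add_bismutTorsion u z v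
      have h1 := S.g_J_left z (A v u)
      rw [map_sub, map_add, hA', hτ]
      rw [hA', hτ] at h1
      simp only [nablaJ] at h
      linarith
    by_contra h
    exact (S.pos _ (sub_ne_zero.2 h)).ne' (key _)
  · rw [hT, hT, S.bismutTorsion_cycle, S.bismutTorsion_swap]

/-- The exterior derivative of `2 g (·, J ·)` in terms of first derivatives. -/
def dOmega (u v w : V) : ℝ :=
  2 * (S.dg u v (S.J w) + S.g v (S.dJ u w) + S.dg v w (S.J u) + S.g w (S.dJ v u)
    + S.dg w u (S.J v) + S.g u (S.dJ w v))

variable {S} in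
lemma IsBismut.dOmega_eq {A : V →ₗ[ℝ] V →ₗ[ℝ] V} (h : S.IsBismut A) (u v w : V) :
    -(S.dOmega (S.J u) v w + S.dOmega u (S.J v) w + S.dOmega u v (S.J w))
      = 2 * S.g u (A w v - A v w) := by
  let C (l n k : V) : ℝ := S.g l (A k n - A n k)
  have C1 (l n k : V) : C l n k = -C n l k := h.skew l n k
  have C2 (l n k : V) : C l n k = -C l k n := by
    simp only [C, map_sub]; ring
  have Jd (u v : V) : S.dJ u v = S.J (A v u) - A (S.J v) u := eq_sub_of_add_eq (h.parallel u v)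
  -- Substituting the metric and parallel equations for `dg` and `dJ` makes the coefficients `A`
  -- combine into differences `A k n - A n k`: only torsion survives.
  have dΩ (u v w : V) : S.dOmega u v w
      = 2 * (C (S.J w) u v + C (S.J u) v w + C (S.J v) w u) := by
    have a (x y : V) : S.g x (S.J y) = -S.g y (S.J x) := by rw [← S.g_J_left, S.symm]
    simp only [dOmega, C, h.metric, Jd, map_sub]
    have b (x y z : V) : S.g (A x y) (S.J z) = S.g (S.J z) (A x y) := S.symm _ _
    simp only [b]
    have c (x y z : V) : S.g x (S.J (A y z)) = - S.g (S.J x) (A y z) := by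
      rw [S.g_J_left]; ring
    simp only [c]
    ring
  -- The Nijenhuis condition with `dJ` eliminated by parallelism: `T(v,w) = T(Jv,Jw) - J T(Jv,w) - J
  -- T(v,Jw)`, paired with `u`.
  have N : C u v w = C u (S.J v) (S.J w) + C (S.J u) (S.J v) w + C (S.J u) v (S.J w) := by
    have n := congrArg (S.g u) (S.nijenhuis v w)
    simp only [Jd, S.sq, map_sub, map_add, map_zero, map_neg] at n
    have c (x y z : V) : S.g x (S.J (A y z)) = - S.g (S.J x) (A y z) := by
      rw [S.g_J_left]; ring
    simp only [c] at n
    simp only [C, map_sub]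
    linarith
  have neg (l n k : V) : C (-l) n k = -C l n k := by
    simp only [C, map_neg, LinearMap.neg_apply]
  -- Each of the three terms contributes `-2 C u v w`, and each mixed term of `N` occurs twice with
  -- coefficient 2. By `N` the total before the outer sign is `2 (-3 + 2) C = -2 C`; cyclic
  -- invariance `s` matches the arguments.
  simp only [dΩ, S.sq, neg]
  change _ = 2 * C u v w
  have s (a b c : V) : C b c a = C a b c := by rw [C2, C1]; simp
  have h1 := s u v w
  have h2 := s v w u
  have h3 := s u (S.J v) (S.J w)
  have h4 := s (S.J v) (S.J w) u
  have h5 := s (S.J u) (S.J v) w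
  have h6 := s (S.J v) w (S.J u)
  have h7 := s (S.J u) v (S.J w)
  have h8 := s v (S.J w) (S.J u)
  linarith

end HermitianJet

open Bundle Topology Filter

/-! ### Tensor fields read in the chart centred at a point. -/

section

variable {E : Type*} [NormedAddCommGroup E] [NormedSpace ℝ E]
  {M : Type*} [TopologicalSpace M] [ChartedSpace E M] [IsManifold 𝓘(ℝ, E) ∞ M]

/-- The differential of the chart centred at `x₀`, at the point with coordinates `y`. -/
def toCoord (x₀ : M) (y : E) :
    TangentSpace 𝓘(ℝ, E) ((extChartAt 𝓘(ℝ, E) x₀).symm y) →L[ℝ] E :=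
  (trivializationAt E (TangentSpace 𝓘(ℝ, E)) x₀).continuousLinearMapAt ℝ
    ((extChartAt 𝓘(ℝ, E) x₀).symm y)

/-- The inverse of the differential of the chart centred at `x₀`, at the point with
coordinates `y`. -/
def ofCoord (x₀ : M) (y : E) :
    E →L[ℝ] TangentSpace 𝓘(ℝ, E) ((extChartAt 𝓘(ℝ, E) x₀).symm y) :=
  (trivializationAt E (TangentSpace 𝓘(ℝ, E)) x₀).symmL ℝ ((extChartAt 𝓘(ℝ, E) x₀).symm y)

/-- A vector field read in the chart centred at `x₀`. -/
def vecRep (x₀ : M) (Y : VecField E M) (y : E) : E :=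
  toCoord x₀ y (Y ((extChartAt 𝓘(ℝ, E) x₀).symm y))

/-- A metric read in the chart centred at `x₀`. -/
def metricRep (g : RiemMetric E M) (x₀ : M) (y : E) : E →L[ℝ] E →L[ℝ] ℝ :=
  (show E →L[ℝ] E →L[ℝ] ℝ from g.inner ((extChartAt 𝓘(ℝ, E) x₀).symm y)).bilinearComp
    (show E →L[ℝ] E from ofCoord x₀ y) (show E →L[ℝ] E from ofCoord x₀ y)

/-- A field of endomorphisms read in the chart centred at `x₀`. -/
def endRep (I : EndField E M) (x₀ : M) (y : E) : E →L[ℝ] E :=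
  (toCoord x₀ y).comp ((I ((extChartAt 𝓘(ℝ, E) x₀).symm y)).comp (ofCoord x₀ y))

omit [IsManifold 𝓘(ℝ, E) ∞ M] in
lemma eventually_mem_chart (x₀ : M) : ∀ᶠ y in 𝓝 (extChartAt 𝓘(ℝ, E) x₀ x₀),
    y ∈ (extChartAt 𝓘(ℝ, E) x₀).target ∧
      (extChartAt 𝓘(ℝ, E) x₀).symm y ∈ (chartAt E x₀).source := by
  filter_upwards [extChartAt_target_mem_nhds (I := 𝓘(ℝ, E)) x₀] with y hy
  refine ⟨hy, ?_⟩
  rw [← extChartAt_source 𝓘(ℝ, E)]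
  exact (extChartAt 𝓘(ℝ, E) x₀).map_target hy

lemma ofCoord_toCoord {x₀ : M} {y : E}
    (hy : (extChartAt 𝓘(ℝ, E) x₀).symm y ∈ (chartAt E x₀).source)
    (v : TangentSpace 𝓘(ℝ, E) ((extChartAt 𝓘(ℝ, E) x₀).symm y)) :
    ofCoord x₀ y (toCoord x₀ y v) = v :=
  (trivializationAt E (TangentSpace 𝓘(ℝ, E)) x₀).symmL_continuousLinearMapAt (R := ℝ) hy v

lemma toCoord_ofCoord {x₀ : M} {y : E}
    (hy : (extChartAt 𝓘(ℝ, E) x₀).symm y ∈ (chartAt E x₀).source) (v : E) :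
    toCoord x₀ y (ofCoord x₀ y v) = v :=
  (trivializationAt E (TangentSpace 𝓘(ℝ, E)) x₀).continuousLinearMapAt_symmL (R := ℝ) hy v

/-- The tangent space at `x₀` is `E`, identified through the preferred chart at `x₀`, so at the
centre of that chart the coordinate change is the identity. This is why each point is studied in its
own chart. -/
lemma continuousLinearMapAt_self (x₀ : M) (v : TangentSpace 𝓘(ℝ, E) x₀) :
    (trivializationAt E (TangentSpace 𝓘(ℝ, E)) x₀).continuousLinearMapAt ℝ x₀ v = v := by
  rw [TangentBundle.continuousLinearMapAt_trivializationAt_eq_core (mem_chart_source E x₀)]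
  exact (tangentBundleCore 𝓘(ℝ, E) M).coordChange_self _ _ (mem_chart_source E x₀) v

lemma symmL_self (x₀ : M) (v : E) :
    (trivializationAt E (TangentSpace 𝓘(ℝ, E)) x₀).symmL ℝ x₀ v = v := by
  rw [TangentBundle.symmL_trivializationAt_eq_core (mem_chart_source E x₀)]
  exact (tangentBundleCore 𝓘(ℝ, E) M).coordChange_self _ _ (mem_chart_source E x₀) v

lemma vecRep_self (x₀ : M) (Y : VecField E M) :
    vecRep x₀ Y (extChartAt 𝓘(ℝ, E) x₀ x₀) = Y x₀ := by
  unfold vecRep toCoord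
  rw [extChartAt_to_inv]
  exact continuousLinearMapAt_self x₀ (Y x₀)

lemma metricRep_self (g : RiemMetric E M) (x₀ : M) (v w : E) :
    metricRep g x₀ (extChartAt 𝓘(ℝ, E) x₀ x₀) v w = g.inner x₀ v w := by
  unfold metricRep ofCoord
  rw [extChartAt_to_inv]
  exact congrArg₂ (fun a b : TangentSpace 𝓘(ℝ, E) x₀ => g.inner x₀ a b) (symmL_self x₀ v)
    (symmL_self x₀ w)

lemma endRep_self (I : EndField E M) (x₀ : M) (v : E) :
    endRep I x₀ (extChartAt 𝓘(ℝ, E) x₀ x₀) v = I x₀ v := by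
  unfold endRep ofCoord toCoord
  rw [extChartAt_to_inv]
  exact (continuousLinearMapAt_self x₀ _).trans (congrArg (I x₀) (symmL_self x₀ v))

lemma vecRep_applyField (I : EndField E M) (x₀ : M) (Y : VecField E M) :
    vecRep x₀ (I.applyField Y) =ᶠ[𝓝 (extChartAt 𝓘(ℝ, E) x₀ x₀)]
      fun y => endRep I x₀ y (vecRep x₀ Y y) := by
  filter_upwards [eventually_mem_chart x₀] with y hy
  change _ = toCoord x₀ y (I _ (ofCoord x₀ y (toCoord x₀ y (Y _))))
  rw [ofCoord_toCoord hy.2]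
  rfl

lemma metricRep_vecRep (g : RiemMetric E M) (x₀ : M) (Y Z : VecField E M) :
    (fun y => g.inner ((extChartAt 𝓘(ℝ, E) x₀).symm y) (Y ((extChartAt 𝓘(ℝ, E) x₀).symm y))
      (Z ((extChartAt 𝓘(ℝ, E) x₀).symm y)))
      =ᶠ[𝓝 (extChartAt 𝓘(ℝ, E) x₀ x₀)]
        fun y => metricRep g x₀ y (vecRep x₀ Y y) (vecRep x₀ Z y) := by
  filter_upwards [eventually_mem_chart x₀] with y hy
  exact (congrArg₂ (fun a b => g.inner ((extChartAt 𝓘(ℝ, E) x₀).symm y) a b)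
    (ofCoord_toCoord hy.2 _) (ofCoord_toCoord hy.2 _)).symm

omit [IsManifold 𝓘(ℝ, E) ∞ M] in
lemma differentiableAt_comp_chart {F : Type*} [NormedAddCommGroup F] [NormedSpace ℝ F]
    {x₀ : M} {f : M → F} (hf : MDifferentiableAt 𝓘(ℝ, E) 𝓘(ℝ, F) f x₀) :
    DifferentiableAt ℝ (fun y => f ((extChartAt 𝓘(ℝ, E) x₀).symm y))
      (extChartAt 𝓘(ℝ, E) x₀ x₀) := by
  have h := hf.differentiableWithinAt_writtenInExtChartAt
  rw [ModelWithCorners.Boundaryless.range_eq_univ, differentiableWithinAt_univ] at h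
  exact h

omit [IsManifold 𝓘(ℝ, E) ∞ M] in
lemma mfderiv_eq_fderiv_comp_chart {F : Type*} [NormedAddCommGroup F] [NormedSpace ℝ F]
    {x₀ : M} {f : M → F} (hf : MDifferentiableAt 𝓘(ℝ, E) 𝓘(ℝ, F) f x₀) (v : E) :
    mfderiv 𝓘(ℝ, E) 𝓘(ℝ, F) f x₀ v
      = fderiv ℝ (fun y => f ((extChartAt 𝓘(ℝ, E) x₀).symm y)) (extChartAt 𝓘(ℝ, E) x₀ x₀) v := by
  have h : mfderiv 𝓘(ℝ, E) 𝓘(ℝ, F) f x₀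
      = fderivWithin ℝ (fun y => f ((extChartAt 𝓘(ℝ, E) x₀).symm y)) (Set.range 𝓘(ℝ, E))
        (extChartAt 𝓘(ℝ, E) x₀ x₀) := if_pos hf
  rw [h, ModelWithCorners.Boundaryless.range_eq_univ, fderivWithin_univ]
  rfl

lemma differentiableAt_vecRep {x₀ : M} {Y : VecField E M} (hY : MDiffAt (T% Y) x₀) :
    DifferentiableAt ℝ (vecRep x₀ Y) (extChartAt 𝓘(ℝ, E) x₀ x₀) := by
  rw [mdifferentiableAt_section] at hY
  refine (differentiableAt_comp_chart hY).congr_of_eventuallyEq ?_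
  filter_upwards [eventually_mem_chart x₀] with y hy
  exact (trivializationAt E (TangentSpace 𝓘(ℝ, E)) x₀).continuousLinearMapAt_apply_of_mem
    (R := ℝ) hy.2 _

/-- The extension of a tangent vector with constant coefficients in the chart. -/
def constField (x₀ : M) (v : E) : VecField E M :=
  FiberBundle.extend E (x := x₀) (E := (TangentSpace 𝓘(ℝ, E) : M → Type _)) v

lemma mdifferentiableAt_constField (x₀ : M) (v : E) : MDiffAt (T% (constField x₀ v)) x₀ :=
  FiberBundle.mdifferentiableAt_extend ..

lemma constField_self (x₀ : M) (v : E) : constField x₀ v x₀ = v :=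
  FiberBundle.extend_apply_self ..

lemma vecRep_constField (x₀ : M) (v : E) :
    vecRep x₀ (constField x₀ v) =ᶠ[𝓝 (extChartAt 𝓘(ℝ, E) x₀ x₀)] fun _ => v := by
  filter_upwards [eventually_mem_chart x₀] with y hy
  have h : constField x₀ v ((extChartAt 𝓘(ℝ, E) x₀).symm y) = ofCoord x₀ y v := by
    have h1 : (trivializationAt E (TangentSpace 𝓘(ℝ, E)) x₀ ⟨x₀, v⟩).2 = v := by
      exact ((trivializationAt E (TangentSpace 𝓘(ℝ, E)) x₀).continuousLinearMapAt_apply_of_mem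
        (R := ℝ) (mem_chart_source E x₀) v).symm.trans (continuousLinearMapAt_self x₀ v)
    unfold constField FiberBundle.extend ofCoord
    rw [Trivialization.symmL_apply _ hy.2]
    congr 1
  rw [vecRep, h, toCoord_ofCoord hy.2]

lemma mdifferentiableAt_applyField {I : EndField E M} (hI : IsComplexStructure I) {x₀ : M}
    {Y : VecField E M} (hY : MDiffAt (T% Y) x₀) : MDiffAt (T% (I.applyField Y)) x₀ :=
  ((hI.smooth x₀).mdifferentiableAt (by simp)).clm_bundle_apply hY

lemma mdifferentiableAt_inner (g : RiemMetric E M) {x₀ : M}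
    {Y Z : VecField E M} (hY : MDiffAt (T% Y) x₀) (hZ : MDiffAt (T% Z) x₀) :
    MDifferentiableAt 𝓘(ℝ, E) 𝓘(ℝ, ℝ) (fun y => g.inner y (Y y) (Z y)) x₀ := by
  have h : MDifferentiableAt 𝓘(ℝ, E) (𝓘(ℝ, E).prod 𝓘(ℝ))
      (fun m ↦ TotalSpace.mk' ℝ (E := Bundle.Trivial M ℝ) m (g.inner m (Y m) (Z m))) x₀ := by
    apply MDifferentiableAt.clm_bundle_apply₂ (F₁ := E) (F₂ := E)
    · exact (g.contMDiff x₀).mdifferentiableAt (by simp)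
    · exact hY
    · exact hZ
  simp only [mdifferentiableAt_totalSpace] at h
  exact h.2

/-- For finite-dimensional `F` the space `F →L[ℝ] G` is a finite power of `G`, so differentiability
can be tested on vectors. Metrics and endomorphisms thus need only be evaluated on constant fields.
-/
lemma differentiableAt_of_apply {F G : Type*} [NormedAddCommGroup F] [NormedSpace ℝ F]
    [NormedAddCommGroup G] [NormedSpace ℝ G] [FiniteDimensional ℝ F] {f : E → F →L[ℝ] G} {y : E}
    (h : ∀ v, DifferentiableAt ℝ (fun z => f z v) y) : DifferentiableAt ℝ f y := by
  let d := Module.finrank ℝ F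
  have hd : d = Module.finrank ℝ (Fin d → ℝ) := (Module.finrank_fin_fun ℝ).symm
  let e₁ := ContinuousLinearEquiv.ofFinrankEq hd
  let e₂ := (e₁.arrowCongr (1 : G ≃L[ℝ] G)).trans (ContinuousLinearEquiv.piRing (Fin d))
  rw [← Function.id_comp f, ← e₂.symm_comp_self]
  exact e₂.symm.differentiableAt.comp y (differentiableAt_pi.2 fun i => h _)

lemma differentiableAt_metricRep [FiniteDimensional ℝ E] (g : RiemMetric E M) (x₀ : M) :
    DifferentiableAt ℝ (metricRep g x₀) (extChartAt 𝓘(ℝ, E) x₀ x₀) := by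
  refine differentiableAt_of_apply fun v => differentiableAt_of_apply fun w => ?_
  refine (differentiableAt_comp_chart (mdifferentiableAt_inner g
    (mdifferentiableAt_constField x₀ v)
    (mdifferentiableAt_constField x₀ w))).congr_of_eventuallyEq ?_
  filter_upwards [metricRep_vecRep g x₀ (constField x₀ v) (constField x₀ w),
    vecRep_constField x₀ v, vecRep_constField x₀ w] with y h hv hw
  rw [h, hv, hw]

lemma differentiableAt_endRep [FiniteDimensional ℝ E] {I : EndField E M}
    (hI : IsComplexStructure I) (x₀ : M) :
    DifferentiableAt ℝ (endRep I x₀) (extChartAt 𝓘(ℝ, E) x₀ x₀) := by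
  refine differentiableAt_of_apply fun v => ?_
  refine (differentiableAt_vecRep (mdifferentiableAt_applyField hI
    (mdifferentiableAt_constField x₀ v))).congr_of_eventuallyEq ?_
  filter_upwards [vecRep_applyField I x₀ (constField x₀ v), vecRep_constField x₀ v] with y h hv
  rw [h, hv]

end

/-! ### The flat connection of the centred charts. -/

section

variable {E : Type*} [NormedAddCommGroup E] [NormedSpace ℝ E]
  {M : Type*} [TopologicalSpace M] [ChartedSpace E M] [IsManifold 𝓘(ℝ, E) ∞ M]

lemma vecRep_add (x₀ : M) (Y Z : VecField E M) :
    vecRep x₀ (Y + Z) = vecRep x₀ Y + vecRep x₀ Z :=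
  funext fun y => map_add (toCoord x₀ y) _ _

lemma vecRep_smul (x₀ : M) (f : M → ℝ) (Y : VecField E M) :
    vecRep x₀ (f • Y) = fun y => f ((extChartAt 𝓘(ℝ, E) x₀).symm y) • vecRep x₀ Y y :=
  funext fun y => map_smul (toCoord x₀ y) _ _

/-- The connection which at each point `x` is the flat one of the chart centred at `x`. -/
def chartConnection : Connection E M where
  toFun Y x := show E →L[ℝ] E from fderiv ℝ (vecRep x Y) (extChartAt 𝓘(ℝ, E) x x)
  -- The chart varies with `x`, so nothing is claimed about smooth dependence on `x`. Additivity and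
  -- the Leibniz rule are conditions at one point, hence rules for `fderiv` in one chart.
  isCovariantDerivativeOnUniv :=
    { add := by
        intro Y Z x hY hZ _
        have h := fderiv_add (differentiableAt_vecRep hY) (differentiableAt_vecRep hZ)
        rw [← vecRep_add] at h
        exact h
      leibniz := by
        intro Y f x hY hf _
        refine ContinuousLinearMap.ext fun v => ?_
        have h := congrArg (fun L : E →L[ℝ] E => L v)
          (fderiv_fun_smul (differentiableAt_comp_chart hf) (differentiableAt_vecRep hY))
        have h1 := mfderiv_eq_fderiv_comp_chart hf v
        rw [← vecRep_smul] at h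
        refine h.trans ?_
        simp only [add_apply, smul_apply, ContinuousLinearMap.smulRight_apply]
        rw [← h1, vecRep_self, extChartAt_to_inv]
        rfl }

lemma chartConnection_apply (Y : VecField E M) (x : M) (v : E) :
    chartConnection Y x v = fderiv ℝ (vecRep x Y) (extChartAt 𝓘(ℝ, E) x x) v := by
  rfl

lemma mfderiv_extChartAt_self (x₀ : M) :
    mfderiv 𝓘(ℝ, E) 𝓘(ℝ, E) (extChartAt 𝓘(ℝ, E) x₀) x₀ = ContinuousLinearMap.id ℝ E := by
  rw [← TangentBundle.continuousLinearMapAt_trivializationAt (mem_chart_source E x₀)]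
  exact ContinuousLinearMap.ext fun v => continuousLinearMapAt_self x₀ v

lemma mfderivWithin_extChartAt_symm {x₀ : M} {y : E}
    (hy : y ∈ (extChartAt 𝓘(ℝ, E) x₀).target ∧
      (extChartAt 𝓘(ℝ, E) x₀).symm y ∈ (chartAt E x₀).source) :
    mfderivWithin 𝓘(ℝ, E) 𝓘(ℝ, E) (extChartAt 𝓘(ℝ, E) x₀).symm (Set.range 𝓘(ℝ, E)) y
      = ofCoord x₀ y := by
  have h := TangentBundle.symmL_trivializationAt (I := 𝓘(ℝ, E)) hy.2
  rw [(extChartAt 𝓘(ℝ, E) x₀).right_inv hy.1] at h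
  exact h.symm

lemma mfderiv_extChartAt_symm {x₀ : M} {y : E}
    (hy : y ∈ (extChartAt 𝓘(ℝ, E) x₀).target ∧
      (extChartAt 𝓘(ℝ, E) x₀).symm y ∈ (chartAt E x₀).source) :
    mfderiv 𝓘(ℝ, E) 𝓘(ℝ, E) (extChartAt 𝓘(ℝ, E) x₀).symm y = ofCoord x₀ y := by
  rw [← mfderivWithin_extChartAt_symm hy, ModelWithCorners.Boundaryless.range_eq_univ,
    mfderivWithin_univ]

lemma mpullbackWithin_eq_vecRep (x₀ : M) (Y : VecField E M) :
    VectorField.mpullbackWithin 𝓘(ℝ, E) 𝓘(ℝ, E) (extChartAt 𝓘(ℝ, E) x₀).symm Y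
      (Set.range 𝓘(ℝ, E)) =ᶠ[𝓝 (extChartAt 𝓘(ℝ, E) x₀ x₀)] vecRep x₀ Y := by
  filter_upwards [eventually_mem_chart x₀] with y hy
  rw [VectorField.mpullbackWithin_apply, mfderivWithin_extChartAt_symm hy]
  have h : ContinuousLinearMap.inverse (ofCoord x₀ y) = toCoord x₀ y :=
    ContinuousLinearMap.inverse_eq (ContinuousLinearMap.ext fun v => ofCoord_toCoord hy.2 v)
      (ContinuousLinearMap.ext fun v => toCoord_ofCoord hy.2 v)
  exact congrArg (fun L : TangentSpace 𝓘(ℝ, E) ((extChartAt 𝓘(ℝ, E) x₀).symm y) →L[ℝ] E =>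
    L (Y ((extChartAt 𝓘(ℝ, E) x₀).symm y))) h

/-- The connection `chartConnection` has no torsion. -/
lemma mlieBracket_eq_chartConnection (X Y : VecField E M) (x : M) :
    VectorField.mlieBracket 𝓘(ℝ, E) X Y x
      = chartConnection Y x (X x) - chartConnection X x (Y x) := by
  rw [← VectorField.mlieBracketWithin_univ, VectorField.mlieBracketWithin_apply,
    mfderiv_extChartAt_self]
  have key : ∀ V W : E → E, V =ᶠ[𝓝 (extChartAt 𝓘(ℝ, E) x x)] vecRep x X →
      W =ᶠ[𝓝 (extChartAt 𝓘(ℝ, E) x x)] vecRep x Y →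
      VectorField.lieBracketWithin ℝ V W
        ((extChartAt 𝓘(ℝ, E) x).symm ⁻¹' Set.univ ∩ Set.range 𝓘(ℝ, E)) (extChartAt 𝓘(ℝ, E) x x)
        = fderiv ℝ (vecRep x Y) (extChartAt 𝓘(ℝ, E) x x) (X x)
          - fderiv ℝ (vecRep x X) (extChartAt 𝓘(ℝ, E) x x) (Y x) := by
    intro V W hV hW
    rw [Set.preimage_univ, Set.univ_inter, ModelWithCorners.Boundaryless.range_eq_univ,
      VectorField.lieBracketWithin_univ, VectorField.lieBracket]
    rw [hV.fderiv_eq, hW.fderiv_eq, hV.eq_of_nhds, hW.eq_of_nhds, vecRep_self, vecRep_self]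
  refine Eq.trans ?_ (key _ _ (mpullbackWithin_eq_vecRep x X) (mpullbackWithin_eq_vecRep x Y))
  exact congrArg (fun L : E →L[ℝ] E => L _) ContinuousLinearMap.inverse_id

lemma fderiv_metric [FiniteDimensional ℝ E] (g : RiemMetric E M) {Y Z : VecField E M} {x : M}
    (hY : MDiffAt (T% Y) x) (hZ : MDiffAt (T% Z) x) (v : E) :
    mfderiv 𝓘(ℝ, E) 𝓘(ℝ, ℝ) (fun y => g.inner y (Y y) (Z y)) x v
      = fderiv ℝ (metricRep g x) (extChartAt 𝓘(ℝ, E) x x) v (Y x) (Z x)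
        + metricRep g x (extChartAt 𝓘(ℝ, E) x x) (chartConnection Y x v) (Z x)
        + metricRep g x (extChartAt 𝓘(ℝ, E) x x) (Y x) (chartConnection Z x v) := by
  have h := ((differentiableAt_metricRep g x).hasFDerivAt.clm_apply
    (differentiableAt_vecRep hY).hasFDerivAt).clm_apply (differentiableAt_vecRep hZ).hasFDerivAt
  refine (mfderiv_eq_fderiv_comp_chart (mdifferentiableAt_inner g hY hZ) v).trans ?_
  rw [(metricRep_vecRep g x Y Z).fderiv_eq, h.fderiv]
  simp only [chartConnection_apply, add_apply, ContinuousLinearMap.coe_comp,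
    Function.comp_apply, ContinuousLinearMap.flip_apply]
  simp only [vecRep_self]
  -- Tangent spaces equal `E` only by unfolding, so the algebra is stated over a plain space and
  -- transferred by `exact`; the later `key` statements serve the same purpose.
  have comm : ∀ a b c : ℝ, a + (b + c) = c + b + a := fun a b c => by ring
  exact comm _ _ _

lemma chartConnection_applyField [FiniteDimensional ℝ E] {I : EndField E M}
    (hI : IsComplexStructure I) {Y : VecField E M} {x : M} (hY : MDiffAt (T% Y) x) (v : E) :
    chartConnection (I.applyField Y) x v
      = fderiv ℝ (endRep I x) (extChartAt 𝓘(ℝ, E) x x) v (Y x)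
        + endRep I x (extChartAt 𝓘(ℝ, E) x x) (chartConnection Y x v) := by
  have h := (differentiableAt_endRep hI x).hasFDerivAt.clm_apply
    (differentiableAt_vecRep hY).hasFDerivAt
  rw [chartConnection_apply, (vecRep_applyField I x Y).fderiv_eq, h.fderiv]
  simp only [chartConnection_apply, add_apply, ContinuousLinearMap.coe_comp,
    Function.comp_apply, ContinuousLinearMap.flip_apply]
  simp only [vecRep_self]
  exact add_comm _ _

lemma chartConnection_constField (x : M) (v u : E) :
    chartConnection (constField x v) x u = 0 := by
  rw [chartConnection_apply, (vecRep_constField x v).fderiv_eq, fderiv_fun_const]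
  rfl

end

/-! ### The jet of a Hermitian structure at a point. -/

section

variable {E : Type*} [NormedAddCommGroup E] [NormedSpace ℝ E]
  {M : Type*} [TopologicalSpace M] [ChartedSpace E M] [IsManifold 𝓘(ℝ, E) ∞ M]

lemma metricRep_symm (g : RiemMetric E M) (x : M) (y v w : E) :
    metricRep g x y v w = metricRep g x y w v :=
  g.symm ((extChartAt 𝓘(ℝ, E) x).symm y) (ofCoord x y v) (ofCoord x y w)

lemma endRep_sq {I : EndField E M} (hI : IsComplexStructure I) {x : M} {y : E}
    (hy : (extChartAt 𝓘(ℝ, E) x).symm y ∈ (chartAt E x).source) (v : E) :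
    endRep I x y (endRep I x y v) = -v := by
  change toCoord x y (I _ (ofCoord x y (toCoord x y (I _ (ofCoord x y v))))) = -v
  rw [ofCoord_toCoord hy, hI.sq_eq_neg, map_neg, toCoord_ofCoord hy]

lemma metricRep_endRep {g : RiemMetric E M} {I : EndField E M} (hg : IsHermitian g I) {x : M}
    {y : E} (hy : (extChartAt 𝓘(ℝ, E) x).symm y ∈ (chartAt E x).source) (v w : E) :
    metricRep g x y (endRep I x y v) (endRep I x y w) = metricRep g x y v w := by
  change g.inner _ (ofCoord x y (toCoord x y (I _ (ofCoord x y v))))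
    (ofCoord x y (toCoord x y (I _ (ofCoord x y w))))
    = g.inner _ (ofCoord x y v) (ofCoord x y w)
  rw [ofCoord_toCoord hy, ofCoord_toCoord hy, hg]

variable [FiniteDimensional ℝ E]

/-- Evaluate the Nijenhuis tensor on constant fields: they commute, and the other brackets only see
derivatives of the endomorphism. -/
lemma fderiv_endRep_nijenhuis {I : EndField E M} (hI : IsComplexStructure I) (x : M) (u v : E) :
    fderiv ℝ (endRep I x) (extChartAt 𝓘(ℝ, E) x x) (endRep I x (extChartAt 𝓘(ℝ, E) x x) u) v
      - fderiv ℝ (endRep I x) (extChartAt 𝓘(ℝ, E) x x) (endRep I x (extChartAt 𝓘(ℝ, E) x x) v) u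
      + endRep I x (extChartAt 𝓘(ℝ, E) x x)
        (fderiv ℝ (endRep I x) (extChartAt 𝓘(ℝ, E) x x) v u)
      - endRep I x (extChartAt 𝓘(ℝ, E) x x)
        (fderiv ℝ (endRep I x) (extChartAt 𝓘(ℝ, E) x x) u v) = 0 := by
  have h := hI.nijenhuis_eq_zero (constField x u) (constField x v) x
    (mdifferentiableAt_constField x u) (mdifferentiableAt_constField x v)
  have hu (a : E) := chartConnection_applyField hI (mdifferentiableAt_constField x u) a
  have hv (a : E) := chartConnection_applyField hI (mdifferentiableAt_constField x v) a
  have cu : constField x u x = u := constField_self x u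
  have cv : constField x v x = v := constField_self x v
  have e (a : E) : I x a = endRep I x (extChartAt 𝓘(ℝ, E) x x) a := (endRep_self I x a).symm
  have du (a : E) : chartConnection (constField x u) x a = 0 := chartConnection_constField x u a
  have dv (a : E) : chartConnection (constField x v) x a = 0 := chartConnection_constField x v a
  have hu' (a : E) : chartConnection (I.applyField (constField x u)) x a
      = fderiv ℝ (endRep I x) (extChartAt 𝓘(ℝ, E) x x) a u := by
    exact (hu a).trans ((congrArg₂ (fun b c : E => b + c) (congrArg _ cu)
      ((congrArg (endRep I x (extChartAt 𝓘(ℝ, E) x x)) (du a)).trans (map_zero _))).trans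
      (add_zero _))
  have hv' (a : E) : chartConnection (I.applyField (constField x v)) x a
      = fderiv ℝ (endRep I x) (extChartAt 𝓘(ℝ, E) x x) a v := by
    exact (hv a).trans ((congrArg₂ (fun b c : E => b + c) (congrArg _ cv)
      ((congrArg (endRep I x (extChartAt 𝓘(ℝ, E) x x)) (dv a)).trans (map_zero _))).trans
      (add_zero _))
  have iu : I.applyField (constField x u) x = endRep I x (extChartAt 𝓘(ℝ, E) x x) u := by
    rw [← e]; exact congrArg (I x) cu
  have iv : I.applyField (constField x v) x = endRep I x (extChartAt 𝓘(ℝ, E) x x) v := by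
    rw [← e]; exact congrArg (I x) cv
  simp only [mlieBracket_eq_chartConnection] at h
  rw [cu, cv, iu, iv, hu', hv', hu', hv', du, du, dv, dv] at h
  have key : ∀ L : E →L[ℝ] E, (∀ a, L a = endRep I x (extChartAt 𝓘(ℝ, E) x x) a) →
      ∀ a b c d : E, a - b + endRep I x (extChartAt 𝓘(ℝ, E) x x) c
        - endRep I x (extChartAt 𝓘(ℝ, E) x x) d
        = a - b - L (0 - c) - L (d - 0) - (0 - 0) := by
    intro L hL a b c d; simp [hL]
  exact (key (I x) e _ _ _ _).trans h

/-- The first-order jet of a Hermitian structure, read in the chart centred at `x`. -/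
def jetAt {g : RiemMetric E M} {I : EndField E M} (hI : IsComplexStructure I)
    (hg : IsHermitian g I) (x : M) : HermitianJet E where
  g := (metricRep g x (extChartAt 𝓘(ℝ, E) x x)).toLinearMap₁₂
  J := endRep I x (extChartAt 𝓘(ℝ, E) x x)
  dg := (fderiv ℝ (metricRep g x) (extChartAt 𝓘(ℝ, E) x x)).toLinearMap₁₂.compr₂
    (ContinuousLinearMap.coeLM ℝ)
  dJ := (fderiv ℝ (endRep I x) (extChartAt 𝓘(ℝ, E) x x)).toLinearMap₁₂
  symm := metricRep_symm g x _
  pos v hv := by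
    change 0 < metricRep g x _ v v
    rw [metricRep_self]
    exact g.pos x v hv
  sq := endRep_sq hI (eventually_mem_chart x).self_of_nhds.2
  herm := metricRep_endRep hg (eventually_mem_chart x).self_of_nhds.2
  -- This and the next two fields differentiate an identity valid near the centre of the chart and
  -- compare derivatives by uniqueness.
  dg_symm u v w := by
    have hG := (differentiableAt_metricRep g x).hasFDerivAt
    have h1 := (hG.clm_apply (hasFDerivAt_const v _)).clm_apply (hasFDerivAt_const w _)
    have h2 := (hG.clm_apply (hasFDerivAt_const w _)).clm_apply (hasFDerivAt_const v _)
    have h := h1.unique (h2.congr_of_eventuallyEq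
      (Eventually.of_forall fun y => metricRep_symm g x y v w))
    have := congrArg (fun L : E →L[ℝ] ℝ => L u) h
    simpa using this
  dsq u v := by
    have hJ := (differentiableAt_endRep hI x).hasFDerivAt
    have h1 := hJ.clm_apply (hJ.clm_apply (hasFDerivAt_const v _))
    have h2 : HasFDerivAt (fun y => endRep I x y (endRep I x y v)) (0 : E →L[ℝ] E)
        (extChartAt 𝓘(ℝ, E) x x) := by
      refine (hasFDerivAt_const (-v) _).congr_of_eventuallyEq ?_
      filter_upwards [eventually_mem_chart x] with y hy using endRep_sq hI hy.2 v
    have := congrArg (fun L : E →L[ℝ] E => L u) (h1.unique h2)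
    simpa [add_comm] using this
  dherm u v w := by
    have hG := (differentiableAt_metricRep g x).hasFDerivAt
    have hJ := (differentiableAt_endRep hI x).hasFDerivAt
    have h1 := (hG.clm_apply (hasFDerivAt_const v _)).clm_apply (hasFDerivAt_const w _)
    have h2 := (hG.clm_apply (hJ.clm_apply (hasFDerivAt_const v _))).clm_apply
      (hJ.clm_apply (hasFDerivAt_const w _))
    have h := (h2.congr_of_eventuallyEq (f₁ := fun y => metricRep g x y v w) ?_).unique h1
    · have := congrArg (fun L : E →L[ℝ] ℝ => L u) h
      simp at this
      simp
      linarith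
    · filter_upwards [eventually_mem_chart x] with y hy
      exact (metricRep_endRep hg hy.2 v w).symm
  nijenhuis := fderiv_endRep_nijenhuis hI x

end

/-! ### The fundamental form, its exterior derivative and `d_I` in coordinates. -/

section

variable {E : Type*} [NormedAddCommGroup E] [NormedSpace ℝ E]
  {M : Type*} [TopologicalSpace M] [ChartedSpace E M] [IsManifold 𝓘(ℝ, E) ∞ M]

/-- A continuous bilinear form as a continuous multilinear map in two variables. -/
def bilinToMultilinear (B : E →L[ℝ] E →L[ℝ] ℝ) :
    ContinuousMultilinearMap ℝ (fun _ : Fin 2 => E) ℝ where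
  toFun v := B (v 0) (v 1)
  map_update_add' := by
    intro inst m i a b
    obtain rfl : inst = instDecidableEqFin 2 := Subsingleton.elim _ _
    fin_cases i <;> simp
  map_update_smul' := by
    intro inst m i a b
    obtain rfl : inst = instDecidableEqFin 2 := Subsingleton.elim _ _
    fin_cases i <;> simp
  cont := by
    change Continuous fun v : Fin 2 → E => B (v 0) (v 1)
    fun_prop

lemma bilinToMultilinear_apply (B : E →L[ℝ] E →L[ℝ] ℝ) (v : Fin 2 → E) :
    bilinToMultilinear B v = B (v 0) (v 1) := rfl

lemma alternatization_two {V : Type*} [AddCommGroup V] [Module ℝ V] [TopologicalSpace V]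
    (T : ContinuousMultilinearMap ℝ (fun _ : Fin 2 => V) ℝ) (v : Fin 2 → V) :
    ContinuousMultilinearMap.alternatization T v = T v - T ![v 1, v 0] := by
  have h : (Finset.univ : Finset (Equiv.Perm (Fin 2))) = {1, Equiv.swap 0 1} := by decide
  have e : (fun i => v (Equiv.swap (0 : Fin 2) 1 i)) = ![v 1, v 0] := by
    funext i; fin_cases i <;> rfl
  rw [ContinuousMultilinearMap.alternatization_apply_apply, h,
    Finset.sum_pair (by decide : (1 : Equiv.Perm (Fin 2)) ≠ Equiv.swap 0 1), ← e,
    Equiv.Perm.sign_swap (by decide : (0 : Fin 2) ≠ 1), Equiv.Perm.sign_one, one_smul,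
    Units.neg_smul, one_smul, sub_eq_add_neg]
  rfl

/-- Antisymmetrization of bilinear forms. -/
def altOfBilin : (E →L[ℝ] E →L[ℝ] ℝ) →ₗ[ℝ] E [⋀^Fin 2]→L[ℝ] ℝ where
  toFun B := ContinuousMultilinearMap.alternatization (bilinToMultilinear B)
  map_add' B C := by
    ext v
    rw [ContinuousAlternatingMap.add_apply]
    simp only [alternatization_two, bilinToMultilinear_apply, add_apply]
    ring
  map_smul' c B := by
    ext v
    rw [ContinuousAlternatingMap.smul_apply]
    simp only [alternatization_two, bilinToMultilinear_apply, smul_apply, RingHom.id_apply,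
      smul_eq_mul]
    ring

lemma altOfBilin_apply (B : E →L[ℝ] E →L[ℝ] ℝ) (v : Fin 2 → E) :
    altOfBilin B v = B (v 0) (v 1) - B (v 1) (v 0) :=
  alternatization_two _ _

/-- The tensor `g (·, I ·)` read in the chart centred at `x`. -/
def loweredRep (g : RiemMetric E M) (I : EndField E M) (x : M) (y : E) : E →L[ℝ] E →L[ℝ] ℝ :=
  (metricRep g x y).bilinearComp (ContinuousLinearMap.id ℝ E) (endRep I x y)

lemma loweredRep_apply (g : RiemMetric E M) (I : EndField E M) (x : M) (y v w : E) :
    loweredRep g I x y v w = metricRep g x y v (endRep I x y w) := rfl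

lemma inChart_fundamentalForm (g : RiemMetric E M) (I : EndField E M) (x : M) :
    inChart (fundamentalForm g I) x =ᶠ[𝓝 (extChartAt 𝓘(ℝ, E) x x)]
      fun y => altOfBilin (loweredRep g I x y) := by
  filter_upwards [eventually_mem_chart x] with y hy
  ext v
  rw [altOfBilin_apply, loweredRep_apply, loweredRep_apply]
  unfold inChart
  rw [mfderiv_extChartAt_symm hy]
  refine (alternatization_two (lowered g I ((extChartAt 𝓘(ℝ, E) x).symm y))
    (fun i => ofCoord x y (v i))).trans ?_
  have h (a b : E) : metricRep g x y a (endRep I x y b)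
      = g.inner ((extChartAt 𝓘(ℝ, E) x).symm y) (ofCoord x y a)
        (I ((extChartAt 𝓘(ℝ, E) x).symm y) (ofCoord x y b)) := by
    change g.inner _ (ofCoord x y a) (ofCoord x y (toCoord x y (I _ (ofCoord x y b)))) = _
    rw [ofCoord_toCoord hy.2]
  rw [h, h]
  rfl

section

variable [FiniteDimensional ℝ E]

lemma hasFDerivAt_loweredRep_apply (g : RiemMetric E M) {I : EndField E M}
    (hI : IsComplexStructure I) (hg : IsHermitian g I) (x : M) (v w : E) :
    DifferentiableAt ℝ (fun y => loweredRep g I x y v w) (extChartAt 𝓘(ℝ, E) x x) ∧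
    ∀ u, fderiv ℝ (fun y => loweredRep g I x y v w) (extChartAt 𝓘(ℝ, E) x x) u
      = (jetAt hI hg x).dg u v ((jetAt hI hg x).J w)
        + (jetAt hI hg x).g v ((jetAt hI hg x).dJ u w) := by
  have hG := (differentiableAt_metricRep g x).hasFDerivAt
  have hJ := (differentiableAt_endRep hI x).hasFDerivAt
  have h := (hG.clm_apply (hasFDerivAt_const v _)).clm_apply
    (hJ.clm_apply (hasFDerivAt_const w _))
  refine ⟨h.differentiableAt, fun u => ?_⟩
  simp only [loweredRep_apply]
  rw [h.fderiv]
  simp [jetAt]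
  ring

lemma differentiableAt_loweredRep (g : RiemMetric E M) {I : EndField E M}
    (hI : IsComplexStructure I) (hg : IsHermitian g I) (x : M) :
    DifferentiableAt ℝ (loweredRep g I x) (extChartAt 𝓘(ℝ, E) x x) :=
  differentiableAt_of_apply fun v => differentiableAt_of_apply fun w =>
    (hasFDerivAt_loweredRep_apply g hI hg x v w).1

lemma fderiv_loweredRep (g : RiemMetric E M) {I : EndField E M}
    (hI : IsComplexStructure I) (hg : IsHermitian g I) (x : M) (u v w : E) :
    fderiv ℝ (loweredRep g I x) (extChartAt 𝓘(ℝ, E) x x) u v w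
      = (jetAt hI hg x).dg u v ((jetAt hI hg x).J w)
        + (jetAt hI hg x).g v ((jetAt hI hg x).dJ u w) := by
  rw [← (hasFDerivAt_loweredRep_apply g hI hg x v w).2 u]
  have h := (((differentiableAt_loweredRep g hI hg x).hasFDerivAt.clm_apply
    (hasFDerivAt_const v _)).clm_apply (hasFDerivAt_const w _)).fderiv
  rw [h]
  simp

/-- The tensor `g (v, J w)` is antisymmetric near the centre, because `J` is an isometry with `J² =
-1`; hence so is its derivative. -/
lemma fderiv_loweredRep_swap (g : RiemMetric E M) {I : EndField E M}
    (hI : IsComplexStructure I) (hg : IsHermitian g I) (x : M) (u v w : E) :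
    fderiv ℝ (loweredRep g I x) (extChartAt 𝓘(ℝ, E) x x) u v w
      = -fderiv ℝ (loweredRep g I x) (extChartAt 𝓘(ℝ, E) x x) u w v := by
  have h1 := ((differentiableAt_loweredRep g hI hg x).hasFDerivAt.clm_apply
    (hasFDerivAt_const v _)).clm_apply (hasFDerivAt_const w _)
  have h2 := (((differentiableAt_loweredRep g hI hg x).hasFDerivAt.clm_apply
    (hasFDerivAt_const w _)).clm_apply (hasFDerivAt_const v _)).neg
  have h := (h1.congr_of_eventuallyEq (f₁ := fun y => -loweredRep g I x y w v) ?_).unique h2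
  · have := congrArg (fun L : E →L[ℝ] ℝ => L u) h
    simpa using this
  · filter_upwards [eventually_mem_chart x] with y hy
    rw [loweredRep_apply, loweredRep_apply, metricRep_symm, ← metricRep_endRep hg hy.2 v,
      endRep_sq hI hy.2, map_neg]

omit [FiniteDimensional ℝ E] in
lemma hasFDerivAt_linearMap_comp {F G : Type*} [NormedAddCommGroup F] [NormedSpace ℝ F]
    [FiniteDimensional ℝ F] [NormedAddCommGroup G] [NormedSpace ℝ G] (T : F →ₗ[ℝ] G)
    {f : E → F} {f' : E →L[ℝ] F} {y : E} (hf : HasFDerivAt f f' y) :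
    HasFDerivAt (fun z => T (f z)) ((LinearMap.toContinuousLinearMap T).comp f') y :=
  (LinearMap.toContinuousLinearMap T).hasFDerivAt.comp y hf

set_option maxSynthPendingDepth 3 in
lemma extD_fundamentalForm (g : RiemMetric E M) {I : EndField E M}
    (hI : IsComplexStructure I) (hg : IsHermitian g I) (x : M) (v : Fin 3 → E) :
    extD (fundamentalForm g I) x v = (jetAt hI hg x).dOmega (v 0) (v 1) (v 2) := by
  have hd := hasFDerivAt_linearMap_comp altOfBilin
    (differentiableAt_loweredRep g hI hg x).hasFDerivAt
  have h1 : extDeriv (inChart (fundamentalForm g I) x) (extChartAt 𝓘(ℝ, E) x x) v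
      = (jetAt hI hg x).dOmega (v 0) (v 1) (v 2) := by
    rw [(inChart_fundamentalForm g I x).extDeriv_eq, extDeriv,
      ContinuousAlternatingMap.alternatizeUncurryFin_apply]
    have e (u : E) (m : Fin 2 → E) :
        fderiv ℝ (fun y => altOfBilin (loweredRep g I x y)) (extChartAt 𝓘(ℝ, E) x x) u m
          = 2 * fderiv ℝ (loweredRep g I x) (extChartAt 𝓘(ℝ, E) x x) u (m 0) (m 1) := by
      have h2 : fderiv ℝ (fun y => altOfBilin (loweredRep g I x y)) (extChartAt 𝓘(ℝ, E) x x) u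
          = altOfBilin (fderiv ℝ (loweredRep g I x) (extChartAt 𝓘(ℝ, E) x x) u) :=
        congrArg (fun L : E →L[ℝ] E [⋀^Fin 2]→L[ℝ] ℝ => L u) hd.fderiv
      rw [h2, altOfBilin_apply, fderiv_loweredRep_swap g hI hg x u (m 1)]
      ring
    simp only [e, Fin.removeNth_apply]
    -- Turns the middle term of the alternating sum, which carries a minus sign, into the cyclic
    -- order used by `dOmega`.
    have s := fderiv_loweredRep_swap g hI hg x (v 1) (v 0) (v 2)
    have e0 := fderiv_loweredRep g hI hg x (v 0) (v 1) (v 2)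
    have e1 := fderiv_loweredRep g hI hg x (v 1) (v 2) (v 0)
    have e2 := fderiv_loweredRep g hI hg x (v 2) (v 0) (v 1)
    simp [Fin.succAbove, Fin.sum_univ_three] at s e0 e1 e2 ⊢
    rw [HermitianJet.dOmega]
    linarith
  refine Eq.trans ?_ h1
  unfold extD
  rw [mfderiv_extChartAt_self]
  rfl

omit [FiniteDimensional ℝ E] [IsManifold 𝓘(ℝ, E) ∞ M] in
lemma derivationExt_apply {n : ℕ} {V : Type*} [AddCommGroup V] [Module ℝ V] [TopologicalSpace V]
    (A : V →L[ℝ] V) (α : V [⋀^Fin n]→L[ℝ] ℝ) (v : Fin n → V) :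
    derivationExt A α v = ∑ k, α (Function.update v k (A (v k))) := by
  change (∑ i : Fin n, α.toContinuousMultilinearMap.compContinuousLinearMap
      (Function.update (fun _ => ContinuousLinearMap.id ℝ V) i A)) v = _
  rw [sum_apply]
  refine Finset.sum_congr rfl fun k _ => ?_
  refine congrArg α (funext fun l => ?_)
  by_cases h : l = k
  · subst h; simp
  · simp [h]

omit [FiniteDimensional ℝ E] in
lemma fundamentalForm_apply {g : RiemMetric E M} {I : EndField E M}
    (hI : IsComplexStructure I) (hg : IsHermitian g I) (x : M)
    (v : Fin 2 → TangentSpace 𝓘(ℝ, E) x) :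
    fundamentalForm g I x v = 2 * g.inner x (v 0) (I x (v 1)) := by
  refine (alternatization_two (lowered g I x) v).trans ?_
  have h : g.inner x (v 1) (I x (v 0)) = -g.inner x (v 0) (I x (v 1)) := by
    rw [← hg, hI.sq_eq_neg, map_neg, g.symm]
  have key : ∀ a b : ℝ, b = -a → a - b = 2 * a := fun a b hab => by rw [hab]; ring
  exact key _ _ h

-- `Ω` has type (1,1): `Ω(Iv, w) + Ω(v, Iw) = 0`. Hence only `-ι d` contributes to `d_I Ω`.
omit [FiniteDimensional ℝ E] in
lemma iotaOp_fundamentalForm {g : RiemMetric E M} {I : EndField E M}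
    (hI : IsComplexStructure I) (hg : IsHermitian g I) : iotaOp I (fundamentalForm g I) = 0 := by
  funext x
  refine ContinuousAlternatingMap.ext fun v => ?_
  refine (derivationExt_apply _ _ _).trans ?_
  rw [Fin.sum_univ_two, fundamentalForm_apply hI hg, fundamentalForm_apply hI hg]
  simp only [Function.update_self, Function.update_of_ne (show (1 : Fin 2) ≠ 0 by decide),
    Function.update_of_ne (show (0 : Fin 2) ≠ 1 by decide), hI.sq_eq_neg, map_neg]
  have key : ∀ a b : ℝ, a = b → 2 * a + 2 * -b = 0 := fun a b h => by rw [h]; ring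
  exact key _ _ (hg x (v 0) (v 1))

omit [FiniteDimensional ℝ E] [IsManifold 𝓘(ℝ, E) ∞ M] in
lemma inChart_zero (n : ℕ) (x : M) : inChart (0 : DiffForm E M n) x = 0 := by
  funext y
  exact ContinuousAlternatingMap.ext fun v => rfl

omit [FiniteDimensional ℝ E] [IsManifold 𝓘(ℝ, E) ∞ M] in
lemma extD_zero (n : ℕ) : extD (0 : DiffForm E M n) = 0 := by
  funext x
  unfold extD
  have h : extDeriv (0 : E → E [⋀^Fin n]→L[ℝ] ℝ) (extChartAt 𝓘(ℝ, E) x x) = 0 := by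
    ext v
    simp [extDeriv, ContinuousAlternatingMap.alternatizeUncurryFin_apply]
  rw [inChart_zero, h]
  exact ContinuousAlternatingMap.ext fun v => rfl

lemma dOp_fundamentalForm {g : RiemMetric E M} {I : EndField E M}
    (hI : IsComplexStructure I) (hg : IsHermitian g I) (x : M) (v : Fin 3 → E) :
    dOp I (fundamentalForm g I) x v = -((jetAt hI hg x).dOmega ((jetAt hI hg x).J (v 0)) (v 1) (v 2)
      + (jetAt hI hg x).dOmega (v 0) ((jetAt hI hg x).J (v 1)) (v 2)
      + (jetAt hI hg x).dOmega (v 0) (v 1) ((jetAt hI hg x).J (v 2))) := by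
  have h : dOp I (fundamentalForm g I) x v
      = -derivationExt (I x) (extD (fundamentalForm g I) x) v := by
    unfold dOp
    rw [iotaOp_fundamentalForm hI hg, extD_zero, zero_sub]
    rfl
  have e (a : E) : I x a = (jetAt hI hg x).J a := (endRep_self I x a).symm
  refine h.trans (congrArg Neg.neg ((derivationExt_apply (I x) _ v).trans ?_))
  refine (Finset.sum_congr rfl fun k _ =>
    (congrArg (fun a => extD (fundamentalForm g I) x (Function.update v k a)) (e (v k))).trans
      (extD_fundamentalForm g hI hg x _)).trans ?_
  rw [Fin.sum_univ_three]
  rfl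

end

end

/-! ### Passing between connections on `M` and coefficients at each point. -/

section

variable {E : Type*} [NormedAddCommGroup E] [NormedSpace ℝ E] [FiniteDimensional ℝ E]
  {M : Type*} [TopologicalSpace M] [ChartedSpace E M] [IsManifold 𝓘(ℝ, E) ∞ M]

/-- `A` gives the coefficients of the connection `D` at `x` in the chart centred at `x`. -/
def HasCoeffAt (D : Connection E M) (x : M)
    (A : TangentSpace 𝓘(ℝ, E) x →L[ℝ] TangentSpace 𝓘(ℝ, E) x →L[ℝ] TangentSpace 𝓘(ℝ, E) x) :
    Prop :=
  ∀ Y : VecField E M, MDiffAt (T% Y) x → ∀ v, D Y x v = chartConnection Y x v + A (Y x) v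

/-- The difference of two connections is tensorial. -/
lemma exists_hasCoeffAt (D : Connection E M) (x : M) : ∃ A, HasCoeffAt (M := M) D x A := by
  have : CompleteSpace E := FiniteDimensional.complete ℝ E
  refine ⟨CovariantDerivative.difference D chartConnection x, fun Y hY v => ?_⟩
  have h := D.isCovariantDerivativeOnUniv.difference_apply
    chartConnection.isCovariantDerivativeOnUniv (Set.mem_univ x) hY
  have h' : ∀ L P Q : E →L[ℝ] E, L = P - Q → P v = Q v + L v := by
    rintro L P Q rfl; exact (add_sub_cancel (Q v) (P v)).symm
  exact h' _ _ _ h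

omit [FiniteDimensional ℝ E] in
lemma HasCoeffAt.constField {D : Connection E M} {x : M} {A : E →L[ℝ] E →L[ℝ] E}
    (hA : HasCoeffAt D x A) (u v : E) : D (constField x v) x u = A v u := by
  refine (hA _ (mdifferentiableAt_constField x v) u).trans ?_
  have h1 : (chartConnection (TorsionGeometry.constField x v) x u : E) = 0 :=
    chartConnection_constField x v u
  have h2 : (TorsionGeometry.constField x v x : E) = v := constField_self x v
  exact (congrArg₂ (fun a b : E => a + A b u) h1 h2).trans (zero_add _)

lemma HasCoeffAt.torsion_eq {D : Connection E M} {x : M} {A : E →L[ℝ] E →L[ℝ] E}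
    (hA : HasCoeffAt D x A) (u v : E) : torsion D x u v = A v u - A u v := by
  have : CompleteSpace E := FiniteDimensional.complete ℝ E
  have h := CovariantDerivative.torsion_apply D (mdifferentiableAt_constField x u)
    (mdifferentiableAt_constField x v)
  have hu : (TorsionGeometry.constField x u x : E) = u := constField_self x u
  have hv : (TorsionGeometry.constField x v x : E) = v := constField_self x v
  rw [mlieBracket_eq_chartConnection, hu, hv, hA.constField, hA.constField,
    chartConnection_constField, chartConnection_constField] at h
  have key : ∀ a b : E, a - b - (0 - 0) = a - b := fun a b => by simp
  exact h.trans (key _ _)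

lemma HasCoeffAt.torsionTensor_apply {D : Connection E M} {x : M} {A : E →L[ℝ] E →L[ℝ] E}
    (hA : HasCoeffAt D x A) {g : RiemMetric E M} {I : EndField E M} (hI : IsComplexStructure I)
    (hg : IsHermitian g I) (v : Fin 3 → E) :
    torsionTensor g D x v = (jetAt hI hg x).g (v 0) (A (v 2) (v 1) - A (v 1) (v 2)) := by
  refine (congrArg (g.inner x (v 0)) (hA.torsion_eq (v 1) (v 2))).trans ?_
  exact (metricRep_self g x (v 0) (A (v 2) (v 1) - A (v 1) (v 2))).symm

/-- The derivatives of `Y` and `Z` occur identically on both sides and cancel. What remains depends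
only on values at `x`, so constant fields suffice in one direction and arbitrary fields are covered
in the other. -/
lemma HasCoeffAt.metric_iff {D : Connection E M} {x : M} {A : E →L[ℝ] E →L[ℝ] E}
    (hA : HasCoeffAt D x A) {g : RiemMetric E M} {I : EndField E M} (hI : IsComplexStructure I)
    (hg : IsHermitian g I) {Y Z : VecField E M} (hY : MDiffAt (T% Y) x) (hZ : MDiffAt (T% Z) x)
    (v : E) :
    mfderiv 𝓘(ℝ, E) 𝓘(ℝ, ℝ) (fun y => g.inner y (Y y) (Z y)) x v
        = g.inner x (D Y x v) (Z x) + g.inner x (Y x) (D Z x v) ↔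
      (jetAt hI hg x).dg v (Y x) (Z x)
        = (jetAt hI hg x).g (A (Y x) v) (Z x) + (jetAt hI hg x).g (Y x) (A (Z x) v) := by
  have key (G G' dG : E →L[ℝ] E →L[ℝ] ℝ) (hG : ∀ a b, G a b = G' a b) (m : ℝ)
      (y z p q a b r s : E) (hm : m = dG y z + G p z + G y q) (hr : r = p + a) (hs : s = q + b) :
      m = G' r z + G' y s ↔ dG y z = G a z + G y b := by
    rw [hm, hr, hs, ← hG, ← hG]
    simp only [map_add, add_apply]
    constructor <;> intro h <;> linarith
  exact key _ _ _ (metricRep_self g x) _ _ _ _ _ _ _ _ _ (fderiv_metric g hY hZ v) (hA Y hY v)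
    (hA Z hZ v)

lemma HasCoeffAt.parallel_iff {D : Connection E M} {x : M} {A : E →L[ℝ] E →L[ℝ] E}
    (hA : HasCoeffAt D x A) {g : RiemMetric E M} {I : EndField E M} (hI : IsComplexStructure I)
    (hg : IsHermitian g I) {Y : VecField E M} (hY : MDiffAt (T% Y) x) (v : E) :
    D (I.applyField Y) x v = I x (D Y x v) ↔
      (jetAt hI hg x).dJ v (Y x) + A ((jetAt hI hg x).J (Y x)) v
        = (jetAt hI hg x).J (A (Y x) v) := by
  have key (J J' : E →L[ℝ] E) (hJ : ∀ a, J a = J' a) (l r y c d p q : E)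
      (hl : l = c + A (J' y) v) (hc : c = q + J p) (hr : r = p + d) :
      l = J' r ↔ q + A (J y) v = J d := by
    rw [hl, hc, hr, ← hJ, ← hJ, map_add, add_right_comm, add_comm (J p), add_left_inj]
  exact key _ _ (endRep_self I x) _ _ _ _ _ _ _ (hA _ (mdifferentiableAt_applyField hI hY) v)
    (chartConnection_applyField hI hY v) (hA Y hY v)

/-- The two adjacent transpositions generate the symmetric group; the third transposition is a
conjugate of one by the other. -/
lemma skew_of_swap {V : Type*} {T : (Fin 3 → V) → ℝ}
    (h01 : ∀ v, T (v ∘ Equiv.swap 0 1) = -T v) (h12 : ∀ v, T (v ∘ Equiv.swap 1 2) = -T v)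
    (σ : Equiv.Perm (Fin 3)) (v : Fin 3 → V) :
    T (v ∘ σ) = ((Equiv.Perm.sign σ : ℤ) : ℝ) * T v := by
  have h02 (v : Fin 3 → V) : T (v ∘ Equiv.swap 0 2) = -T v := by
    have e : Equiv.swap (0 : Fin 3) 2 = Equiv.swap 0 1 * Equiv.swap 1 2 * Equiv.swap 0 1 := by
      decide
    rw [e, Equiv.Perm.coe_mul, Equiv.Perm.coe_mul, ← Function.comp_assoc, ← Function.comp_assoc,
      h01, h12, h01, neg_neg]
  have hswap (i j : Fin 3) (hij : i ≠ j) (v : Fin 3 → V) : T (v ∘ Equiv.swap i j) = -T v := by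
    fin_cases i <;> fin_cases j <;>
      first
      | exact absurd rfl hij
      | exact h01 v
      | exact h12 v
      | exact h02 v
      | exact (Equiv.swap_comm (0 : Fin 3) 1 ▸ h01 v)
      | exact (Equiv.swap_comm (1 : Fin 3) 2 ▸ h12 v)
      | exact (Equiv.swap_comm (0 : Fin 3) 2 ▸ h02 v)
  induction σ using Equiv.Perm.swap_induction_on generalizing v with
  | one => simp
  | swap_mul σ i j hij ih =>
    rw [Equiv.Perm.coe_mul, ← Function.comp_assoc, ih, hswap i j hij, Equiv.Perm.sign_mul,
      Equiv.Perm.sign_swap hij]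
    push_cast
    ring

lemma IsBismutConnection.isBismut {g : RiemMetric E M} {I : EndField E M}
    {D : Connection E M} (h : IsBismutConnection g I D) (hI : IsComplexStructure I)
    (hg : IsHermitian g I) {x : M} {A : E →L[ℝ] E →L[ℝ] E} (hA : HasCoeffAt D x A) :
    (jetAt hI hg x).IsBismut A.toLinearMap₁₂ where
  metric u v w := by
    have h1 := (hA.metric_iff hI hg (mdifferentiableAt_constField x v)
      (mdifferentiableAt_constField x w) u).1 (h.metric _ _ x (mdifferentiableAt_constField x v)
        (mdifferentiableAt_constField x w) u)
    have hv : (TorsionGeometry.constField x v x : E) = v := constField_self x v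
    have hw : (TorsionGeometry.constField x w x : E) = w := constField_self x w
    rw [hv, hw] at h1
    exact h1
  parallel u v := by
    have h1 := (hA.parallel_iff hI hg (mdifferentiableAt_constField x v) u).1
      (h.parallel _ x (mdifferentiableAt_constField x v) u)
    have hv : (TorsionGeometry.constField x v x : E) = v := constField_self x v
    rw [hv] at h1
    exact h1
  skew l n k := by
    have key (a b c d : ℝ) (h1 : a = ((Equiv.Perm.sign (Equiv.swap (0 : Fin 3) 1) : ℤ) : ℝ) * b)
        (h2 : a = d) (h3 : b = c) : c = -d := by
      rw [← h3, ← h2, h1, Equiv.Perm.sign_swap (by decide)]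
      simp
    exact key _ _ _ _ (h.skew x (Equiv.swap 0 1) ![l, n, k]) (hA.torsionTensor_apply hI hg _)
      (hA.torsionTensor_apply hI hg _)

lemma isBismutConnection_of_isBismut {g : RiemMetric E M} {I : EndField E M}
    {D : Connection E M} (hI : IsComplexStructure I) (hg : IsHermitian g I)
    (A : Π _ : M, E →L[ℝ] E →L[ℝ] E) (hA : ∀ x, HasCoeffAt D x (A x))
    (h : ∀ x, (jetAt hI hg x).IsBismut (A x).toLinearMap₁₂) : IsBismutConnection g I D where
  metric _ _ x hY hZ v := ((hA x).metric_iff hI hg hY hZ v).2 ((h x).metric v _ _)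
  parallel _ x hY v := ((hA x).parallel_iff hI hg hY v).2 ((h x).parallel v _)
  skew x σ v := by
    refine skew_of_swap (T := torsionTensor g D x) (fun v => ?_) (fun v => ?_) σ v
    · exact ((hA x).torsionTensor_apply hI hg _).trans (((h x).skew _ _ _).trans
        (congrArg Neg.neg ((hA x).torsionTensor_apply hI hg v).symm))
    -- Antisymmetry in the last two slots is automatic for torsion; only the first swap uses the
    -- Bismut condition.
    · refine ((hA x).torsionTensor_apply hI hg _).trans (Eq.trans ?_
        (congrArg Neg.neg ((hA x).torsionTensor_apply hI hg v).symm))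
      have key (L : E →ₗ[ℝ] ℝ) (a b : E) : L (a - b) = -L (b - a) := by
        rw [← map_neg, neg_sub]
      exact key _ _ _

lemma exists_isBismutConnection {g : RiemMetric E M} {I : EndField E M}
    (hI : IsComplexStructure I) (hg : IsHermitian g I) :
    ∃ D : Connection E M, IsBismutConnection g I D := by
  -- Coefficients are chosen independently at each point; this suffices because the conditions on a
  -- `Connection` are themselves pointwise.
  choose A hA using fun x : M => (jetAt hI hg x).exists_isBismut
  refine ⟨chartConnection.addOneForm fun x => (A x).toContinuousBilinearMap,
    isBismutConnection_of_isBismut hI hg (fun x => (A x).toContinuousBilinearMap)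
      (fun x Y hY v => ?_) (fun x => ?_)⟩
  · rfl
  · exact hA x

/-- A totally antisymmetric tensor is a multiple of its antisymmetrization. -/
lemma alternatization_of_skew {V : Type*} [AddCommGroup V] [Module ℝ V] [TopologicalSpace V]
    {n : ℕ} (T : ContinuousMultilinearMap ℝ (fun _ : Fin n => V) ℝ)
    (h : ∀ (σ : Equiv.Perm (Fin n)) v, T (v ∘ σ) = ((Equiv.Perm.sign σ : ℤ) : ℝ) * T v)
    (v : Fin n → V) :
    ContinuousMultilinearMap.alternatization T v = n.factorial * T v := by
  rw [ContinuousMultilinearMap.alternatization_apply_apply]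
  have e (σ : Equiv.Perm (Fin n)) : Equiv.Perm.sign σ • T (fun i => v (σ i)) = T v := by
    rw [show (fun i => v (σ i)) = v ∘ σ from rfl, h σ v]
    rcases Int.units_eq_one_or (Equiv.Perm.sign σ) with hs | hs <;>
      rw [hs] <;> simp [Units.smul_def]
  refine (Finset.sum_congr rfl fun σ _ => e σ).trans ?_
  simp [Fintype.card_perm]

lemma IsBismutConnection.dOp_fundamentalForm {g : RiemMetric E M} {I : EndField E M}
    {D : Connection E M} (h : IsBismutConnection g I D) (hI : IsComplexStructure I)
    (hg : IsHermitian g I) :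
    dOp I (fundamentalForm g I) = (1 / 3 : ℝ) • (torsionTensor g D).toForm := by
  funext x
  refine ContinuousAlternatingMap.ext fun v => ?_
  obtain ⟨A, hA⟩ := exists_hasCoeffAt D x
  have h1 := (TorsionGeometry.dOp_fundamentalForm hI hg x v).trans
    ((h.isBismut hI hg hA).dOmega_eq _ _ _)
  have h2 := alternatization_of_skew (torsionTensor g D x) (h.skew x) v
  have h3 := hA.torsionTensor_apply hI hg v
  -- The value `2 C` of `d_I Ω` meets the value `3! C` of the associated form: `2 = (1/3) · 6`.
  have key : ∀ a b c d : ℝ, a = 2 * b → c = (Nat.factorial 3 : ℕ) * d → d = b →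
      a = (1 / 3) * c := by
    rintro a b c d rfl rfl rfl
    norm_num [Nat.factorial]
    ring
  exact key _ _ _ _ h1 h2 h3

end

end TorsionGeometry

end

open TorsionGeometry
theorem proposition3 {E : Type*} [NormedAddCommGroup E] [NormedSpace ℝ E] [FiniteDimensional ℝ E]
    {M : Type*} [TopologicalSpace M] [ChartedSpace E M] [IsManifold 𝓘(ℝ, E) ∞ M]
    (g : RiemMetric E M) :
    (∀ I : EndField E M, IsComplexStructure I → IsHermitian g I →
      (∃ D : Connection E M, IsBismutConnection g I D) ∧
      ∀ D : Connection E M, IsBismutConnection g I D →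
        dOp I (fundamentalForm g I) = (1 / 3 : ℝ) • (torsionTensor g D).toForm) ∧
    (∀ I J K : EndField E M, IsHKT g I J K →
      dOp I (fundamentalForm g I) = dOp J (fundamentalForm g J) ∧
      dOp J (fundamentalForm g J) = dOp K (fundamentalForm g K)) := by
  refine ⟨fun I hI hg => ⟨exists_isBismutConnection hI hg, fun D hD =>
    hD.dOp_fundamentalForm hI hg⟩, fun I J K h => ?_⟩
  -- The torsion form depends on `g` and `D` alone, so one connection gives the same value for all
  -- three structures.
  obtain ⟨D, hDI, hDJ, hDK⟩ := h.common_bismut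
  rw [hDI.dOp_fundamentalForm h.complex_I h.hermitian_I,
    hDJ.dOp_fundamentalForm h.complex_J h.hermitian_J,
    hDK.dOp_fundamentalForm h.complex_K h.hermitian_K]
  exact ⟨rfl, rfl⟩
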